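/- **Setting.** Let $G=(V,E)$ be a finite directed graph (parallel edges and self-loops allowed) with a rate capacity $\nu_e>0$ and a transit time $\tau_e>0$ for every edge $e\in E$. Let $I$ be a finite set of commodities; each $i\in I$ has a source $s_i\in V$, a sink $t_i\in V$ and a bounded, integrable network inflow rate $u_i:\mathbb{R}_{\ge 0}\to\mathbb{R}_{\ge 0}$ with bounded support. Let $T:=\sup\{\theta\ge 0 \mid \exists i\in I: u_i(\theta)>0\}$ (with $T:=0$ if there is no inflow). An $s_i$,$t_i$-*walk* is a finite sequence $W=(e^W_1,\dots,e^W_{k_W})$, $k_W\ge 1$, of edges such that $e^W_1$ starts in $s_i$, $e^W_{k_W}$ ends in $t_i$ and each $e^W_{j+1}$ starts where $e^W_j$ ends; nodes and edges may repeat. Let $\mathcal{W}_i$ be the (possibly infinite) set of all $s_i$,$t_i$-walks, $\mathcal{W}:=\{(i,W) \mid i\in I, W\in\mathcal{W}_i\}$ and $\mathcal{R}:=\{(i,W,j) \mid i\in I, W\in\mathcal{W}_i, 1\le j\le k_W\}$. The set of *walk-flows* is $$K:=\Big\{h\in \big(L^2_{\ge 0}([0,T])\big)^{\mathcal{W}}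 \;\Big|\; \forall i\in I: \sum_{W\in\mathcal{W}_i}h_i^W(\theta)=u_i(\theta)\text{ for almost all }\theta\in\mathbb{R}_{\ge 0}\Big\},$$ where functions on $[0,T]$ are extended by $0$. A *flow over time* is a pair $f=(f^+,f^-)$ with $f^+,f^-\in\big(L^2_{\ge 0}(\mathbb{R}_{\ge 0})\big)^{\mathcal{R}}$, with components $f^{W,+}_{i,j}$ (inflow rate) and $f^{W,-}_{i,j}$ (outflow rate). For such $f$ set $$f_e^{\pm}(\theta):=\sum_{(i,W,j)\in\mathcal{R}:\, e^W_j=e} f^{W,\pm}_{i,j}(\theta),\qquad F_{i,j}^{W,\pm}(\theta):=\int_0^\theta f_{i,j}^{W,\pm}(z)\,dz,\qquad F_e^{\pm}(\theta):=\int_0^\theta f_e^{\pm}(z)\,dz,$$ $$q_e(\theta):=F_e^+(\theta)-F_e^-(\theta+\tau_e),\qquad T_e(\theta):=\theta+\tau_e+\frac{q_e(\theta)}{\nu_e}.$$ Given $h\in K$, a flow over time $f$ is a *feasible flow over time associated with $h$* if 1. (source) $f^{W,+}_{i,1}(\theta)=h_i^W(\theta)$ for almost all $\theta\ge 0$, for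 all $(i,W)\in\mathcal{W}$; 2. (node balancing) $f^{W,-}_{i,j}(\theta)=f^{W,+}_{i,j+1}(\theta)$ for almost all $\theta\ge 0$, for all $(i,W)\in\mathcal{W}$ and $1\le j<k_W$; 3. (capacity) $f_e^-(\theta+\tau_e)\le\nu_e$ for almost all $\theta\ge 0$, for all $e\in E$; 4. (weak flow conservation) $F_e^-(\theta+\tau_e)\le F_e^+(\theta)$ for all $\theta\ge 0$ and $e\in E$; 5. (link transfer) $F^{W,-}_{i,j}\big(T_{e^W_j}(\theta)\big)=F^{W,+}_{i,j}(\theta)$ for all $\theta\ge 0$ and $(i,W,j)\in\mathcal{R}$. **Lemma.** For every $h\in K$ there exists a feasible flow over time $f$ associated with $h$, and it is unique up to null sets: every feasible flow over time $g$ associated with $h$ satisfies $g^{W,+}_{i,j}=f^{W,+}_{i,j}$ and $g^{W,-}_{i,j}=f^{W,-}_{i,j}$ almost everywhere on $\mathbb{R}_{\ge 0}$ for all $(i,W,j)\in\mathcal{R}$. -/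

import Mathlib

open MeasureTheory Set
open scoped ENNReal

namespace Vickrey

/-- A directed multigraph (parallel edges and self-loops allowed) with vertex set `V` and edge
set `E`, positive rate capacities `ν e` and positive transit times `τ e`. -/
structure Network (V E : Type*) where
  src : E → V
  tgt : E → V
  ν : E → ℝ
  τ : E → ℝ
  ν_pos : ∀ e, 0 < ν e
  τ_pos : ∀ e, 0 < τ e

/-- A commodity: source node, sink node and a non-negative, bounded, integrable network inflow
rate with bounded support.  Functions on `ℝ≥0` are modelled by functions on `ℝ` of which only the
values at times `θ ≥ 0` matter. -/
structure Commodity (V : Type*) where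
  source : V
  sink : V
  u : ℝ → ℝ
  u_nonneg : ∀ θ, 0 ≤ θ → 0 ≤ u θ
  u_bounded : ∃ B, ∀ θ, 0 ≤ θ → u θ ≤ B
  u_integrable : IntegrableOn u (Ici 0)
  u_support : BddAbove {θ | 0 ≤ θ ∧ 0 < u θ}

/-- Lebesgue measure on `ℝ≥0 = [0, ∞)`, as a measure on `ℝ`. -/
noncomputable def timeMeasure : Measure ℝ := volume.restrict (Ici 0)

section

variable {V E I : Type*}

/-- `W = (e₁, …, e_k)`, `k ≥ 1`, is an `s`,`t`-walk: consecutive edges fit together, the first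
edge leaves `s`, the last one enters `t`.  Nodes and edges may repeat. -/
def Network.IsWalk (N : Network V E) (s t : V) (W : List E) : Prop :=
  ∃ hW : W ≠ [], W.IsChain (fun e e' => N.tgt e = N.src e') ∧
    N.src (W.head hW) = s ∧ N.tgt (W.getLast hW) = t

variable (N : Network V E) (com : I → Commodity V)

/-- The last time at which a vehicle enters the network,
`T = sup {θ ≥ 0 | ∃ i, u_i θ > 0}` (and `0` if there is no inflow at all). -/
noncomputable def lastEntry : ℝ := sSup {θ | 0 ≤ θ ∧ ∃ i, 0 < (com i).u θ}

/-- The set of all `s_i`,`t_i`-walks. -/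
abbrev WalkOf (i : I) : Type _ := {W : List E // N.IsWalk (com i).source (com i).sink W}

/-- The set of all commodity-walk pairs `(i, W)`. -/
abbrev CWalk : Type _ := Σ i : I, WalkOf N com i

/-- The set of all triplets `(i, W, j)` of a commodity, a walk of this commodity and an edge
position in the walk; positions are counted from `0` to `k_W - 1`. -/
abbrev Pos : Type _ := Σ w : CWalk N com, Fin w.2.1.length

variable {N com}

/-- The edge at position `j` of the walk. -/
def Pos.edge (r : Pos N com) : E := r.1.2.1.get r.2

variable (N com)

/-- The set `K` of walk-flows.  Elements of `L²([0,T])` are extended by zero to `[0, ∞)`. -/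
def walkFlows : Set (CWalk N com → ℝ → ℝ) :=
  {h | (∀ w, MemLp (h w) 2 timeMeasure) ∧
       (∀ w, ∀ᵐ θ ∂timeMeasure, 0 ≤ h w θ) ∧
       (∀ w, ∀ᵐ θ ∂timeMeasure, θ ∉ Icc 0 (lastEntry com) → h w θ = 0) ∧
       ∀ i, ∀ᵐ θ ∂timeMeasure, HasSum (fun W : WalkOf N com i => h ⟨i, W⟩ θ) ((com i).u θ)}

/-- A flow over time `(f⁺, f⁻)`: vectors of non-negative `L²` functions on `[0, ∞)`. -/
structure FlowOverTime where
  inflow : Pos N com → ℝ → ℝ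
  outflow : Pos N com → ℝ → ℝ
  inflow_memLp : ∀ r, MemLp (inflow r) 2 timeMeasure
  outflow_memLp : ∀ r, MemLp (outflow r) 2 timeMeasure
  inflow_nonneg : ∀ r, ∀ᵐ θ ∂timeMeasure, 0 ≤ inflow r θ
  outflow_nonneg : ∀ r, ∀ᵐ θ ∂timeMeasure, 0 ≤ outflow r θ

variable {N com}

/-- Aggregated rate of edge `e`: the sum of the rates `g` over all `(i, W, j)` whose `j`-th edge
is `e`.  As there may be infinitely many walks, this sum of non-negative numbers is formed
in `[0, ∞]`. -/
noncomputable def aggRate (g : Pos N com → ℝ → ℝ) (e : E) (θ : ℝ) : ℝ≥0∞ :=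
  ∑' r : {r : Pos N com // r.edge = e}, ENNReal.ofReal (g r.1 θ)

/-- Cumulative aggregated flow of edge `e` up to time `θ`, with values in `[0, ∞]`. -/
noncomputable def aggCum (g : Pos N com → ℝ → ℝ) (e : E) (θ : ℝ) : ℝ≥0∞ :=
  ∫⁻ z in Ioc 0 θ, aggRate g e z

/-- Cumulative flow of a single rate function. -/
noncomputable def cum (g : ℝ → ℝ) (θ : ℝ) : ℝ := ∫ z in (0 : ℝ)..θ, g z

namespace FlowOverTime

variable (f : FlowOverTime N com)

/-- Queue length `q_e(θ) = F_e⁺(θ) - F_e⁻(θ + τ_e)`.  For a feasible flow both terms are finite,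
see `aggCum_outflow_ne_top` and
`aggCum_inflow_ne_top` below. -/
noncomputable def queue (e : E) (θ : ℝ) : ℝ :=
  (aggCum f.inflow e θ).toReal - (aggCum f.outflow e (θ + N.τ e)).toReal

/-- Exit time `T_e(θ) = θ + τ_e + q_e(θ) / ν_e`. -/
noncomputable def exitTime (e : E) (θ : ℝ) : ℝ :=
  θ + (N.τ e + f.queue e θ / N.ν e)

/-- `f` is a feasible flow over time associated with `h`. -/
structure IsFeasible (h : CWalk N com → ℝ → ℝ) : Prop where
  /-- the inflow into the first edge of each walk is the walk-flow -/
  source : ∀ (w : CWalk N com) (hj : 0 < w.2.1.length),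
    ∀ᵐ θ ∂timeMeasure, f.inflow ⟨w, ⟨0, hj⟩⟩ θ = h w θ
  /-- balancing at every intermediate node of a walk -/
  balance : ∀ (w : CWalk N com) (j : ℕ) (hj : j + 1 < w.2.1.length),
    ∀ᵐ θ ∂timeMeasure,
      f.outflow ⟨w, ⟨j, (Nat.lt_succ_self j).trans hj⟩⟩ θ = f.inflow ⟨w, ⟨j + 1, hj⟩⟩ θ
  /-- the aggregated outflow respects the capacities -/
  capacity : ∀ e, ∀ᵐ θ ∂timeMeasure,
    aggRate f.outflow e (θ + N.τ e) ≤ ENNReal.ofReal (N.ν e)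
  /-- weak flow conservation over edges -/
  weak_conservation : ∀ e θ, 0 ≤ θ →
    aggCum f.outflow e (θ + N.τ e) ≤ aggCum f.inflow e θ
  /-- link transfer -/
  link_transfer : ∀ (r : Pos N com) (θ : ℝ), 0 ≤ θ →
    cum (f.outflow r) (f.exitTime r.edge θ) = cum (f.inflow r) θ

end FlowOverTime

theorem FlowOverTime.IsFeasible.aggCum_outflow_ne_top {f : FlowOverTime N com}
    {h : CWalk N com → ℝ → ℝ} (hf : f.IsFeasible h) (e : E) (θ : ℝ) :
    aggCum f.outflow e θ ≠ ∞ := by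
  have h0 : aggCum f.outflow e (N.τ e) = 0 := by
    have := hf.weak_conservation e 0 le_rfl
    simpa [aggCum] using this
  have hcap : ∀ᵐ x : ℝ, x ∈ Ioc (N.τ e) (N.τ e + |θ|) →
      aggRate f.outflow e x ≤ ENNReal.ofReal (N.ν e) := by
    have h1 := (ae_restrict_iff' measurableSet_Ici).1 (hf.capacity e)
    have h2 := (measurePreserving_sub_right volume (N.τ e)).quasiMeasurePreserving.ae h1
    filter_upwards [h2] with x hx hm
    have := hx (show (0 : ℝ) ≤ x - N.τ e by linarith [hm.1])
    simpa using this
  have hsub : Ioc 0 θ ⊆ Ioc 0 (N.τ e) ∪ Ioc (N.τ e) (N.τ e + |θ|) := by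
    intro x hx
    rcases le_or_gt x (N.τ e) with hle | hlt
    · exact Or.inl ⟨hx.1, hle⟩
    · exact Or.inr ⟨hlt, by linarith [hx.2, le_abs_self θ, N.τ_pos e]⟩
  refine ne_top_of_le_ne_top ?_ ((lintegral_mono_set hsub).trans (lintegral_union_le _ _ _))
  refine ENNReal.add_ne_top.2 ⟨?_, ?_⟩
  · have : ∫⁻ z in Ioc 0 (N.τ e), aggRate f.outflow e z = 0 := h0
    simp [this]
  · refine ne_top_of_le_ne_top ?_ (setLIntegral_mono_ae' measurableSet_Ioc hcap)
    simp [ENNReal.mul_eq_top]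

theorem FlowOverTime.IsFeasible.aggCum_inflow_ne_top [Finite E] [Finite I]
    {f : FlowOverTime N com} {h : CWalk N com → ℝ → ℝ} (hf : f.IsFeasible h)
    (hh : h ∈ walkFlows N com) (e : E) (θ : ℝ) : aggCum f.inflow e θ ≠ ∞ := by
  have := Fintype.ofFinite E
  have := Fintype.ofFinite I
  have hbound : ∀ᵐ z : ℝ, z ∈ Ioc 0 θ → aggRate f.inflow e z ≤
      (∑ i, ENNReal.ofReal ((com i).u z)) + ∑ e', aggRate f.outflow e' z := by
    have a1 : ∀ᵐ z ∂timeMeasure, ∀ (w : CWalk N com) (hj : 0 < w.2.1.length),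
        f.inflow ⟨w, ⟨0, hj⟩⟩ z = h w z :=
      ae_all_iff.2 fun w => ae_all_iff.2 fun hj => hf.source w hj
    have a2 : ∀ᵐ z ∂timeMeasure, ∀ (w : CWalk N com) (j : ℕ) (hj : j + 1 < w.2.1.length),
        f.outflow ⟨w, ⟨j, (Nat.lt_succ_self j).trans hj⟩⟩ z = f.inflow ⟨w, ⟨j + 1, hj⟩⟩ z :=
      ae_all_iff.2 fun w => ae_all_iff.2 fun j => ae_all_iff.2 fun hj => hf.balance w j hj
    have a3 : ∀ᵐ z ∂timeMeasure, ∀ w, 0 ≤ h w z := ae_all_iff.2 hh.2.1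
    have a4 := ae_all_iff.2 hh.2.2.2
    have a5 := (ae_restrict_iff' measurableSet_Ici).1 (a1.and (a2.and (a3.and a4)))
    filter_upwards [a5] with z hz hm
    obtain ⟨b1, b2, b3, b4⟩ := hz (show (0 : ℝ) ≤ z from hm.1.le)
    have c1 : ∑' w : CWalk N com, ENNReal.ofReal (h w z) =
        ∑ i, ENNReal.ofReal ((com i).u z) := by
      rw [ENNReal.tsum_sigma', tsum_fintype]
      refine Finset.sum_congr rfl fun i _ => ?_
      rw [← (b4 i).tsum_eq, ENNReal.ofReal_tsum_of_nonneg (fun W => b3 _) (b4 i).summable]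
    have c2 : ∑ e', aggRate f.outflow e' z =
        ∑' r : Pos N com, ENNReal.ofReal (f.outflow r z) := by
      rw [← tsum_fintype (L := SummationFilter.unconditional _)]
      exact ENNReal.tsum_fiberwise (fun r : Pos N com => ENNReal.ofReal (f.outflow r z)) Pos.edge
    rw [← c1, c2, ENNReal.tsum_sigma' (fun r : Pos N com => ENNReal.ofReal (f.outflow r z)),
      ← ENNReal.tsum_add]
    refine (ENNReal.tsum_comp_le_tsum_of_injective Subtype.val_injective
      (fun r : Pos N com => ENNReal.ofReal (f.inflow r z))).trans ?_
    rw [ENNReal.tsum_sigma' (fun r : Pos N com => ENNReal.ofReal (f.inflow r z))]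
    refine ENNReal.tsum_le_tsum fun w => ?_
    rw [tsum_fintype, tsum_fintype]
    have key : ∀ (n : ℕ) (F G : Fin n → ℝ≥0∞) (a : ℝ≥0∞),
        (∀ hn : 0 < n, F ⟨0, hn⟩ = a) →
        (∀ (j : ℕ) (hj : j + 1 < n), G ⟨j, (Nat.lt_succ_self j).trans hj⟩ = F ⟨j + 1, hj⟩) →
        ∑ j, F j ≤ a + ∑ j, G j := by
      intro n F G a h1 h2
      cases n with
      | zero => simp
      | succ n =>
        rw [Fin.sum_univ_succ, Fin.sum_univ_castSucc]
        have e1 : F 0 = a := h1 n.succ_pos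
        have e2 : ∑ i : Fin n, G i.castSucc = ∑ i : Fin n, F i.succ :=
          Finset.sum_congr rfl fun i _ => h2 i.1 (Nat.succ_lt_succ i.2)
        rw [e1, e2]
        exact add_le_add_right le_self_add _
    exact key _ _ _ _ (fun hn => by rw [b1]) (fun j hj => by rw [b2])
  refine ne_top_of_le_ne_top ?_ (setLIntegral_mono_ae' measurableSet_Ioc hbound)
  have hm2 : ∀ e', AEMeasurable (aggRate f.outflow e') (volume.restrict (Ioc 0 θ)) := by
    intro e'
    have hle : volume.restrict (Ioc 0 θ) ≤ timeMeasure :=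
      Measure.restrict_mono (fun x hx => hx.1.le) le_rfl
    exact AEMeasurable.tsum fun r =>
      ((f.outflow_memLp r.1).1.aemeasurable.mono_measure hle).ennreal_ofReal
  rw [lintegral_add_right' _ (Finset.aemeasurable_fun_sum _ fun e' _ => hm2 e'),
    lintegral_finsetSum' _ fun e' _ => hm2 e']
  refine ENNReal.add_ne_top.2 ⟨?_, ENNReal.sum_ne_top.2 fun e' _ =>
    hf.aggCum_outflow_ne_top e' θ⟩
  have hu : ∀ i, IntegrableOn (com i).u (Ioc 0 θ) := fun i =>
    (com i).u_integrable.mono_set fun x hx => hx.1.le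
  rw [lintegral_finsetSum' _ fun i _ => (hu i).aemeasurable.ennreal_ofReal]
  exact ENNReal.sum_ne_top.2 fun i _ => (hu i).lintegral_lt_top.ne

end

end Vickrey

namespace Vickrey

/-! Rates are replaced by the measures on `[0, ∞)` of which they are densities. The inflow measure
`μ` of an edge alone determines its exit times: with `M` the mass arrived so far, a particle
entering at `θ` leaves at `τ + sup_{s ≤ θ} (s + (M θ - M s) / ν)`, the supremum being attained at
the last time the queue was empty. The outflow of each walk is then the pushforward of its inflow
under this exit map. Pushforwards satisfy capacity, weak conservation and link transfer
(`map_exit_le`, `mass_sub_mass_map_exit`, `map_exit_Iic`). Conversely, link transfer together with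
the other constraints forces this exit time and this outflow (`eq_exit_of_link`,
`eq_map_exit_of_link`).

Feasible flows therefore correspond to fixed points of `loadStep`, which feeds the walk-flows into
first edges and the outflow of each edge into the next edge of the walk. As there are finitely many
edges, transit times are at least some `d > 0`, so inflows agreeing before `t` have images agreeing
before `t + d` (`restrict_loadStep_congr`). Induction over multiples of `d` gives uniqueness, and
gluing the stabilizing iterates from zero gives existence. Radon-Nikodym densities of the fixed
point are the required rates. They are square integrable because outflows have bounded density and
finite total mass. -/

/-- Measures describing the cumulative inflow of an edge: absolutely continuous, concentrated on
`[0, ∞)` and finite on every bounded time horizon. -/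
structure IsInflow (μ : Measure ℝ) : Prop where
  ac : μ ≪ volume
  neg : μ (Iio 0) = 0
  fin : ∀ t, μ (Iic t) ≠ ∞

/-- The mass that has arrived up to time `t`. -/
noncomputable def mass (μ : Measure ℝ) (t : ℝ) : ℝ := μ.real (Iic t)

/-- The running supremum of `s - mass μ s / ν`. -/
noncomputable def slack (ν : ℝ) (μ : Measure ℝ) (θ : ℝ) : ℝ :=
  sSup ((fun s => s - mass μ s / ν) '' Iic θ)

/-- The time at which a particle entering at time `θ` leaves an edge with capacity `ν` and transit
time `τ`, when the inflow of the edge is described by `μ`. -/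
noncomputable def exit (ν τ : ℝ) (μ : Measure ℝ) (θ : ℝ) : ℝ :=
  τ + (mass μ θ / ν + slack ν μ θ)

/-! ### Cumulative masses of measures on the line -/

theorem mass_nonneg (μ : Measure ℝ) (t : ℝ) : 0 ≤ mass μ t := measureReal_nonneg

theorem measure_Ioc_eq_sub {μ : Measure ℝ} (hμ : ∀ t, μ (Iic t) ≠ ∞) {s t : ℝ} (h : s ≤ t) :
    μ (Ioc s t) = ENNReal.ofReal (mass μ t - mass μ s) := by
  rw [ENNReal.ofReal_sub _ (mass_nonneg _ _), mass, mass, measureReal_def, measureReal_def,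
    ENNReal.ofReal_toReal (hμ t), ENNReal.ofReal_toReal (hμ s),
    ← measure_sdiff (Iic_subset_Iic.2 h) measurableSet_Iic.nullMeasurableSet (hμ s), Iic_sdiff_Iic]

theorem isLocallyFiniteMeasure_of_Iic {μ : Measure ℝ} (hμ : ∀ t, μ (Iic t) ≠ ∞) :
    IsLocallyFiniteMeasure μ :=
  ⟨fun x => ⟨Iic (x + 1), Iic_mem_nhds (by linarith), (hμ _).lt_top⟩⟩

theorem ext_of_mass {μ μ' : Measure ℝ} (hμ : ∀ t, μ (Iic t) ≠ ∞) (hμ' : ∀ t, μ' (Iic t) ≠ ∞)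
    (h : ∀ t, mass μ t = mass μ' t) : μ = μ' := by
  have := isLocallyFiniteMeasure_of_Iic hμ
  refine Measure.ext_of_Ioc _ _ fun a b hab => ?_
  rw [measure_Ioc_eq_sub hμ hab.le, measure_Ioc_eq_sub hμ' hab.le, h, h]

/-- The function `c * x - mass κ x` is monotone and continuous, so it is the Stieltjes function of a
measure that complements `κ` to `c` times Lebesgue measure. -/
theorem le_smul_volume {κ : Measure ℝ} {c : ℝ} (hκ : ∀ t, κ (Iic t) ≠ ∞)
    (h : ∀ s t, s ≤ t → mass κ t - mass κ s ≤ c * (t - s)) : κ ≤ ENNReal.ofReal c • volume := by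
  have hmono : Monotone (mass κ) := fun s t hst =>
    measureReal_mono (Iic_subset_Iic.2 hst) (hκ t)
  have hc : 0 ≤ c := by
    have h1 := h 0 1 zero_le_one
    have h2 := hmono (zero_le_one (α := ℝ))
    linarith
  have hcont : Continuous (mass κ) := by
    refine (LipschitzWith.of_le_add_mul c.toNNReal fun x y => ?_).continuous
    rw [Real.coe_toNNReal c hc]
    rcases le_total x y with hxy | hxy
    · exact (hmono hxy).trans (le_add_of_nonneg_right (mul_nonneg hc dist_nonneg))
    · rw [Real.dist_eq, abs_of_nonneg (by linarith)]
      have := h y x hxy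
      linarith
  let G : StieltjesFunction ℝ :=
    { toFun := fun x => c * x - mass κ x
      mono' := fun s t hst => by
        have := h s t hst
        simp only
        linarith
      right_continuous' := fun x => by fun_prop }
  have key : ENNReal.ofReal c • volume = κ + G.measure := by
    refine Measure.ext_of_Ioc' _ _ (fun a b _ => ?_) fun a b hab => ?_
    · simp [ENNReal.mul_eq_top]
    · rw [Measure.add_apply, G.measure_Ioc, measure_Ioc_eq_sub hκ hab.le,
        ← ENNReal.ofReal_add (sub_nonneg.2 (hmono hab.le)) (sub_nonneg.2 (G.mono hab.le)),
        Measure.smul_apply, Real.volume_Ioc, smul_eq_mul, ← ENNReal.ofReal_mul hc]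
      congr 1
      change _ = _ + ((c * b - mass κ b) - (c * a - mass κ a))
      ring
  rw [key]
  exact Measure.le_add_right le_rfl

/-! ### Exit times and outflow of a single edge -/

namespace IsInflow

variable {μ : Measure ℝ} {ν τ : ℝ}

theorem mono {μ' : Measure ℝ} (hμ : IsInflow μ) (h : μ' ≤ μ) : IsInflow μ' where
  ac := (Measure.absolutelyContinuous_of_le h).trans hμ.ac
  neg := le_antisymm ((h _).trans hμ.neg.le) bot_le
  fin t := ne_top_of_le_ne_top (hμ.fin t) (h _)

theorem monotone_mass (hμ : IsInflow μ) : Monotone (mass μ) := fun _ t hst =>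
  measureReal_mono (Iic_subset_Iic.2 hst) (hμ.fin t)

theorem mass_of_nonpos (hμ : IsInflow μ) {t : ℝ} (ht : t ≤ 0) : mass μ t = 0 := by
  have h0 : μ (Iic 0) = 0 := by
    rw [← Iio_union_right, measure_union_null_iff]
    exact ⟨hμ.neg, hμ.ac (by simp)⟩
  have : μ (Iic t) = 0 := measure_mono_null (Iic_subset_Iic.2 ht) h0
  simp [mass, Measure.real, this]

theorem ofReal_mass (hμ : IsInflow μ) (t : ℝ) : ENNReal.ofReal (mass μ t) = μ (Iic t) :=
  ENNReal.ofReal_toReal (hμ.fin t)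

theorem continuous_mass (hμ : IsInflow μ) : Continuous (mass μ) := by
  have : NullSingletonClass μ := ⟨fun x => hμ.ac (by simp)⟩
  have : IsLocallyFiniteMeasure μ := isLocallyFiniteMeasure_of_Iic hμ.fin
  have key : mass μ = fun t => ∫ _ in (0 : ℝ)..t, (1 : ℝ) ∂μ := by
    funext t
    rw [← intervalIntegral.integral_Iic_sub_Iic]
    · have := hμ.mass_of_nonpos le_rfl
      simp only [mass] at this
      simp [mass, this]
    · exact integrableOn_const (hμ.fin 0)
    · exact integrableOn_const (hμ.fin t)
  rw [key]
  exact intervalIntegral.continuous_primitive (fun a b => by simp) 0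

theorem le_slack (_hμ : IsInflow μ) (hν : 0 < ν) {s θ : ℝ} (h : s ≤ θ) :
    s - mass μ s / ν ≤ slack ν μ θ := by
  refine le_csSup ⟨θ, ?_⟩ ⟨s, h, rfl⟩
  rintro _ ⟨s', hs', rfl⟩
  have : 0 ≤ mass μ s' / ν := div_nonneg (mass_nonneg _ _) hν.le
  have h2 : s' ≤ θ := hs'
  simp only
  linarith

theorem slack_le {θ c : ℝ} (h : ∀ s ≤ θ, s - mass μ s / ν ≤ c) : slack ν μ θ ≤ c := by
  refine csSup_le ⟨_, θ, self_mem_Iic, rfl⟩ ?_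
  rintro _ ⟨s', hs', rfl⟩
  exact h s' hs'

theorem monotone_slack (hμ : IsInflow μ) (hν : 0 < ν) : Monotone (slack ν μ) := fun _ _ h =>
  slack_le fun _ hs => hμ.le_slack hν (hs.trans h)

theorem slack_sub_le (hμ : IsInflow μ) (hν : 0 < ν) {s t : ℝ} (h : s ≤ t) :
    slack ν μ t ≤ slack ν μ s + (t - s) := by
  refine slack_le fun r hr => ?_
  rcases le_total r s with hrs | hsr
  · linarith [hμ.le_slack hν hrs]
  · have h1 := hμ.le_slack hν (le_refl s)
    have h2 := div_le_div_of_nonneg_right (hμ.monotone_mass hsr) hν.le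
    linarith

theorem continuous_slack (hμ : IsInflow μ) (hν : 0 < ν) : Continuous (slack ν μ) := by
  have : LipschitzWith 1 (slack ν μ) := by
    refine LipschitzWith.of_le_add fun x y => ?_
    rcases le_total x y with h | h
    · exact (hμ.monotone_slack hν h).trans (le_add_of_nonneg_right dist_nonneg)
    · rw [Real.dist_eq, abs_of_nonneg (by linarith)]
      exact hμ.slack_sub_le hν h
  exact this.continuous

theorem continuous_exit (hμ : IsInflow μ) (hν : 0 < ν) : Continuous (exit ν τ μ) :=
  continuous_const.add ((hμ.continuous_mass.div_const _).add (hμ.continuous_slack hν))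

theorem mass_sub_le (hμ : IsInflow μ) (hν : 0 < ν) {s t : ℝ} (h : s ≤ t) :
    mass μ t - mass μ s ≤ ν * (exit ν τ μ t - exit ν τ μ s) := by
  have h1 := mul_le_mul_of_nonneg_left (hμ.monotone_slack hν h) hν.le
  have h2 : ∀ x, ν * exit ν τ μ x = ν * τ + mass μ x + ν * slack ν μ x := fun x => by
    unfold exit; field_simp; ring
  rw [mul_sub, h2, h2]
  linarith

theorem monotone_exit (hμ : IsInflow μ) (hν : 0 < ν) : Monotone (exit ν τ μ) := fun _ _ h =>
  add_le_add_right (add_le_add (div_le_div_of_nonneg_right (hμ.monotone_mass h) hν.le)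
    (hμ.monotone_slack hν h)) τ

theorem add_le_exit (hμ : IsInflow μ) (hν : 0 < ν) (θ : ℝ) : θ + τ ≤ exit ν τ μ θ := by
  have := hμ.le_slack hν (le_refl θ)
  unfold exit
  linarith

theorem exit_of_nonpos (hμ : IsInflow μ) (hν : 0 < ν) {θ : ℝ} (h : θ ≤ 0) :
    exit ν τ μ θ = θ + τ := by
  refine le_antisymm ?_ (hμ.add_le_exit hν θ)
  have : slack ν μ θ ≤ θ := slack_le fun s hs => by
    rw [hμ.mass_of_nonpos (hs.trans h)]; simpa using hs
  unfold exit
  rw [hμ.mass_of_nonpos h]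
  simp only [zero_div]
  linarith

/-- Every time `c` is the exit time of a latest entry time. -/
theorem exists_exit_eq (hμ : IsInflow μ) (hν : 0 < ν) (τ c : ℝ) :
    ∃ σ, exit ν τ μ σ = c ∧ exit ν τ μ ⁻¹' Iic c = Iic σ := by
  have hbdd : BddAbove (exit ν τ μ ⁻¹' Iic c) :=
    ⟨c - τ, fun x hx => by
      have h1 := hμ.add_le_exit (τ := τ) hν x
      have h2 : exit ν τ μ x ≤ c := hx
      linarith⟩
  -- Up to time `0` the edge is empty and the exit time is entry time plus `τ`, so this point shows
  -- that the sublevel set is nonempty.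
  have hmin : exit ν τ μ (min 0 (c - τ)) ≤ c := by
    rw [hμ.exit_of_nonpos hν (min_le_left _ _)]
    linarith [min_le_right 0 (c - τ)]
  have hcl : IsClosed (exit ν τ μ ⁻¹' Iic c) := isClosed_Iic.preimage (hμ.continuous_exit hν)
  have hmem : exit ν τ μ (sSup (exit ν τ μ ⁻¹' Iic c)) ≤ c := hcl.csSup_mem ⟨_, hmin⟩ hbdd
  refine ⟨sSup (exit ν τ μ ⁻¹' Iic c), le_antisymm hmem ?_, ?_⟩
  -- The outer maximum equals `c - τ`; this form supplies the ordering of endpoints for the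
  -- intermediate value theorem.
  · have hmax : c ≤ exit ν τ μ (max (min 0 (c - τ)) (c - τ)) := by
      have := hμ.add_le_exit (τ := τ) hν (max (min 0 (c - τ)) (c - τ))
      linarith [le_max_right (min 0 (c - τ)) (c - τ)]
    obtain ⟨σ, -, hσ⟩ := intermediate_value_Icc (le_max_left _ _)
      (hμ.continuous_exit hν).continuousOn ⟨hmin, hmax⟩
    rw [← hσ]
    exact hμ.monotone_exit hν (le_csSup (hσ ▸ hbdd) (by simp))
  · ext x
    exact ⟨fun hx => le_csSup hbdd hx, fun hx => (hμ.monotone_exit hν hx).trans hmem⟩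

/-- The exit map may be constant on an interval to the right of `θ`, but by `mass_sub_le` no mass
enters there, so the larger preimage differs from `Iic θ` by a null set. -/
theorem map_exit_Iic (hμ : IsInflow μ) (hν : 0 < ν) {μ' : Measure ℝ} (h : μ' ≤ μ) (θ : ℝ) :
    μ'.map (exit ν τ μ) (Iic (exit ν τ μ θ)) = μ' (Iic θ) := by
  obtain ⟨σ, hσ, hpre⟩ := hμ.exists_exit_eq hν τ (exit ν τ μ θ)
  rw [Measure.map_apply (hμ.continuous_exit hν).measurable measurableSet_Iic, hpre]
  have hθσ : θ ≤ σ := by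
    have : θ ∈ exit ν τ μ ⁻¹' Iic (exit ν τ μ θ) := le_refl (exit ν τ μ θ)
    rwa [hpre] at this
  have h0 : μ' (Ioc θ σ) = 0 := by
    refine le_antisymm ((h _).trans ?_) bot_le
    rw [measure_Ioc_eq_sub hμ.fin hθσ]
    have := hμ.mass_sub_le (τ := τ) hν hθσ
    rw [hσ, sub_self, mul_zero] at this
    simpa using this
  rw [← Iic_union_Ioc_eq_Iic hθσ]
  exact le_antisymm ((measure_union_le _ _).trans (by rw [h0, add_zero]))
    (measure_mono subset_union_left)

theorem map_exit_Iic_ne_top (hμ : IsInflow μ) (hν : 0 < ν) (t : ℝ) :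
    μ.map (exit ν τ μ) (Iic t) ≠ ∞ := by
  obtain ⟨σ, rfl, -⟩ := hμ.exists_exit_eq hν τ t
  rw [hμ.map_exit_Iic hν le_rfl]
  exact hμ.fin σ

theorem mass_map_exit (hμ : IsInflow μ) (hν : 0 < ν) (θ : ℝ) :
    mass (μ.map (exit ν τ μ)) (exit ν τ μ θ) = mass μ θ :=
  congrArg ENNReal.toReal (hμ.map_exit_Iic hν le_rfl θ)

/-- The outflow of an edge respects its capacity. -/
theorem map_exit_le (hμ : IsInflow μ) (hν : 0 < ν) :
    μ.map (exit ν τ μ) ≤ ENNReal.ofReal ν • volume := by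
  refine le_smul_volume (hμ.map_exit_Iic_ne_top hν) fun s t hst => ?_
  obtain ⟨a, rfl, -⟩ := hμ.exists_exit_eq hν τ s
  obtain ⟨b, rfl, -⟩ := hμ.exists_exit_eq hν τ t
  rw [hμ.mass_map_exit hν, hμ.mass_map_exit hν]
  rcases le_total a b with h | h
  · exact hμ.mass_sub_le hν h
  · exact (sub_nonpos.2 (hμ.monotone_mass h)).trans (mul_nonneg hν.le (sub_nonneg.2 hst))

/-- The exit time is determined by the length of the queue. -/
theorem mass_sub_mass_map_exit (hμ : IsInflow μ) (hν : 0 < ν) (θ : ℝ) :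
    mass μ θ - mass (μ.map (exit ν τ μ)) (θ + τ) = ν * (exit ν τ μ θ - (θ + τ)) := by
  obtain ⟨σ, hσ, -⟩ := hμ.exists_exit_eq hν τ (θ + τ)
  have hle : σ ≤ θ := by linarith [hμ.add_le_exit (τ := τ) hν σ]
  rw [← hσ, hμ.mass_map_exit hν, hσ]
  have hs : mass μ σ / ν + slack ν μ σ = θ := by
    unfold exit at hσ
    linarith
  -- The particle entering at `σ` leaves at `θ + τ`. For `s` in `[σ, θ]` one has `s - mass μ s / ν ≤
  -- θ - mass μ σ / ν`, which is `slack ν μ σ`, so the supremum does not grow after `σ`.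
  have heq : slack ν μ θ = slack ν μ σ := by
    refine le_antisymm (slack_le fun s hsθ => ?_) (hμ.monotone_slack hν hle)
    rcases le_total s σ with h | h
    · exact hμ.le_slack hν h
    · have := div_le_div_of_nonneg_right (hμ.monotone_mass h) hν.le
      linarith
  have h3 : slack ν μ σ = θ - mass μ σ / ν := by linarith
  unfold exit
  rw [heq, h3]
  field_simp
  ring

theorem map_exit (hμ : IsInflow μ) (hν : 0 < ν) (hτ : 0 ≤ τ) : IsInflow (μ.map (exit ν τ μ)) where
  ac := (Measure.absolutelyContinuous_of_le (hμ.map_exit_le hν)).trans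
    Measure.smul_absolutelyContinuous
  neg := by
    rw [Measure.map_apply (hμ.continuous_exit hν).measurable measurableSet_Iio]
    refine measure_mono_null (fun x hx => ?_) hμ.neg
    have h1 := hμ.add_le_exit (τ := τ) hν x
    have h2 : exit ν τ μ x < 0 := hx
    exact show x < 0 by linarith
  fin := hμ.map_exit_Iic_ne_top hν

end IsInflow

/-! ### Causality -/

theorem mass_congr {μ μ' : Measure ℝ} {t : ℝ} (h : μ.restrict (Iio t) = μ'.restrict (Iio t))
    {s : ℝ} (hs : s < t) : mass μ s = mass μ' s := by
  have := congrArg (fun κ => κ (Iic s)) h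
  simp only [Measure.restrict_apply measurableSet_Iic,
    inter_eq_left.2 (Iic_subset_Iio.2 hs)] at this
  exact congrArg ENNReal.toReal this

theorem exit_congr {ν τ : ℝ} {μ μ' : Measure ℝ} {t : ℝ}
    (h : μ.restrict (Iio t) = μ'.restrict (Iio t)) {s : ℝ} (hs : s < t) :
    exit ν τ μ s = exit ν τ μ' s := by
  have h2 : slack ν μ s = slack ν μ' s := by
    unfold slack
    refine congrArg sSup (image_congr fun r hr => ?_)
    rw [mass_congr h (lt_of_le_of_lt hr hs)]
  unfold exit
  rw [h2, mass_congr h hs]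

/-- Causality: the inflow up to time `t` determines the outflow up to time `t + τ`. -/
theorem map_exit_congr {ν τ : ℝ} {μ μ' κ κ' : Measure ℝ} {t d : ℝ} (hμ : IsInflow μ)
    (hμ' : IsInflow μ') (hν : 0 < ν) (hd : d ≤ τ)
    (h : μ.restrict (Iio t) = μ'.restrict (Iio t)) (hκ : κ.restrict (Iio t) = κ'.restrict (Iio t)) :
    (κ.map (exit ν τ μ)).restrict (Iio (t + d)) = (κ'.map (exit ν τ μ')).restrict (Iio (t + d)) := by
  have hm := (hμ.continuous_exit (τ := τ) hν).measurable
  have hm' := (hμ'.continuous_exit (τ := τ) hν).measurable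
  ext s hs
  rw [Measure.restrict_apply hs, Measure.restrict_apply hs,
    Measure.map_apply hm (hs.inter measurableSet_Iio),
    Measure.map_apply hm' (hs.inter measurableSet_Iio)]
  -- Leaving before `t + d` requires entering before `t`, since the transit takes at least `τ ≥ d`.
  -- Only the common part of the data matters.
  have hlt : ∀ {m : Measure ℝ}, IsInflow m → exit ν τ m ⁻¹' (s ∩ Iio (t + d)) ⊆ Iio t := by
    intro m hm x hx
    have h1 := hm.add_le_exit (τ := τ) hν x
    have h2 : exit ν τ m x < t + d := hx.2
    exact show x < t by linarith
  have heq : exit ν τ μ ⁻¹' (s ∩ Iio (t + d)) = exit ν τ μ' ⁻¹' (s ∩ Iio (t + d)) := by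
    ext x
    constructor
    · intro hx
      have := exit_congr (ν := ν) (τ := τ) h (hlt hμ hx)
      rwa [mem_preimage, this] at hx
    · intro hx
      have := exit_congr (ν := ν) (τ := τ) h (hlt hμ' hx)
      rwa [mem_preimage, ← this] at hx
  have := congrArg (fun κ => κ (exit ν τ μ ⁻¹' (s ∩ Iio (t + d)))) hκ
  simp only [Measure.restrict_apply (hm (hs.inter measurableSet_Iio)),
    inter_eq_left.2 (hlt hμ)] at this
  rw [this, heq]

/-! ### The network loading operator -/

section
variable {V E I : Type*} {N : Network V E} {com : I → Commodity V}

/-- The aggregated measure of an edge. -/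
noncomputable def edgeMeasure (x : Pos N com → Measure ℝ) (e : E) : Measure ℝ :=
  Measure.sum fun r : {r : Pos N com // r.edge = e} => x r.1

/-- The exit time of an edge for given inflow measures. -/
noncomputable def edgeExit (x : Pos N com → Measure ℝ) (e : E) : ℝ → ℝ :=
  exit (N.ν e) (N.τ e) (edgeMeasure x e)

/-- The outflow measures caused by given inflow measures. -/
noncomputable def outMeasure (x : Pos N com → Measure ℝ) (r : Pos N com) : Measure ℝ :=
  (x r).map (edgeExit x r.edge)

/-- One step of the network loading: outflow of an edge becomes inflow of the next edge. -/
noncomputable def loadStep (H : CWalk N com → Measure ℝ) (x : Pos N com → Measure ℝ) :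
    Pos N com → Measure ℝ
  | ⟨w, ⟨0, _⟩⟩ => H w
  | ⟨w, ⟨j + 1, hj⟩⟩ => outMeasure x ⟨w, ⟨j, (Nat.lt_succ_self j).trans hj⟩⟩

theorem sum_subtype_le {ι : Type*} (x : ι → Measure ℝ) (p : ι → Prop) :
    Measure.sum (fun r : {r // p r} => x r.1) ≤ Measure.sum x := by
  refine Measure.le_iff.2 fun s hs => ?_
  rw [Measure.sum_apply _ hs, Measure.sum_apply _ hs]
  exact ENNReal.tsum_comp_le_tsum_of_injective Subtype.val_injective fun r => x r s

theorem le_edgeMeasure (x : Pos N com → Measure ℝ) (r : Pos N com) :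
    x r ≤ edgeMeasure x r.edge :=
  Measure.le_sum (fun s : {s : Pos N com // s.edge = r.edge} => x s.1) ⟨r, rfl⟩

theorem isInflow_edgeMeasure {x : Pos N com → Measure ℝ} (hx : IsInflow (Measure.sum x)) (e : E) :
    IsInflow (edgeMeasure x e) :=
  hx.mono (sum_subtype_le x _)

theorem measurable_edgeExit {x : Pos N com → Measure ℝ} (hx : IsInflow (Measure.sum x)) (e : E) :
    Measurable (edgeExit x e) :=
  ((isInflow_edgeMeasure hx e).continuous_exit (N.ν_pos e)).measurable

/-- All walk positions on one edge are pushed forward by the same exit map, so pushing forward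
commutes with summation. -/
theorem edgeMeasure_outMeasure {x : Pos N com → Measure ℝ} (hx : IsInflow (Measure.sum x))
    (e : E) : edgeMeasure (outMeasure x) e = (edgeMeasure x e).map (edgeExit x e) := by
  have hm := measurable_edgeExit hx e
  ext s hs
  rw [edgeMeasure, Measure.map_apply hm hs, edgeMeasure, Measure.sum_apply _ hs,
    Measure.sum_apply _ (hm hs)]
  refine tsum_congr fun r => ?_
  rw [outMeasure, r.2, Measure.map_apply hm hs]

theorem isInflow_outMeasure {x : Pos N com → Measure ℝ} (hx : IsInflow (Measure.sum x))
    (r : Pos N com) : IsInflow (outMeasure x r) := by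
  have h1 : outMeasure x r ≤ edgeMeasure (outMeasure x) r.edge := le_edgeMeasure _ r
  rw [edgeMeasure_outMeasure hx] at h1
  exact ((isInflow_edgeMeasure hx r.edge).map_exit (N.ν_pos _) (N.τ_pos _).le).mono h1

theorem edgeMeasure_outMeasure_le {x : Pos N com → Measure ℝ} (hx : IsInflow (Measure.sum x))
    (e : E) : edgeMeasure (outMeasure x) e ≤ ENNReal.ofReal (N.ν e) • volume := by
  rw [edgeMeasure_outMeasure hx]
  exact (isInflow_edgeMeasure hx e).map_exit_le (N.ν_pos e)

theorem outMeasure_Iic_le {x : Pos N com → Measure ℝ} (hx : IsInflow (Measure.sum x))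
    (r : Pos N com) (t : ℝ) : outMeasure x r (Iic t) ≤ x r (Iic t) := by
  rw [outMeasure, Measure.map_apply (measurable_edgeExit hx _) measurableSet_Iic]
  refine measure_mono fun s hs => ?_
  have h1 := (isInflow_edgeMeasure hx r.edge).add_le_exit (τ := N.τ r.edge) (N.ν_pos r.edge) s
  have h2 : exit (N.ν r.edge) (N.τ r.edge) (edgeMeasure x r.edge) s ≤ t := hs
  have h3 := N.τ_pos r.edge
  exact show s ≤ t by linarith

theorem sum_le_add_sum_of_shift {n : ℕ} {F G : Fin n → ℝ≥0∞} {a : ℝ≥0∞}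
    (h0 : ∀ hn : 0 < n, F ⟨0, hn⟩ ≤ a)
    (h1 : ∀ (j : ℕ) (hj : j + 1 < n), F ⟨j + 1, hj⟩ ≤ G ⟨j, (Nat.lt_succ_self j).trans hj⟩) :
    ∑ j, F j ≤ a + ∑ j, G j := by
  cases n with
  | zero => simp
  | succ n =>
    rw [Fin.sum_univ_succ, Fin.sum_univ_castSucc]
    exact add_le_add (h0 n.succ_pos) ((Finset.sum_le_sum fun i _ =>
      h1 i.1 (Nat.succ_lt_succ i.2)).trans le_self_add)

/-- Finiteness up to time `t` is the delicate point when there are infinitely many walks: the new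
inflow at position `j + 1` is at most the old inflow at position `j`, as particles leave after
entering, so the total is bounded by network inflow plus old total. -/
theorem isInflow_loadStep {H : CWalk N com → Measure ℝ} (hH : IsInflow (Measure.sum H))
    {x : Pos N com → Measure ℝ} (hx : IsInflow (Measure.sum x)) :
    IsInflow (Measure.sum (loadStep H x)) := by
  have hr : ∀ r, IsInflow (loadStep H x r) := by
    rintro ⟨w, ⟨_ | j, hj⟩⟩
    · exact hH.mono (Measure.le_sum H w)
    · exact isInflow_outMeasure hx _
  refine ⟨Measure.absolutelyContinuous_sum_left fun r => (hr r).ac, ?_, fun t => ?_⟩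
  · rw [Measure.sum_apply _ measurableSet_Iio]
    simp [(hr _).neg]
  · have hle : Measure.sum (loadStep H x) (Iic t) ≤ Measure.sum H (Iic t) +
        Measure.sum x (Iic t) := by
      simp only [Measure.sum_apply _ measurableSet_Iic]
      rw [ENNReal.tsum_sigma' (fun r : Pos N com => loadStep H x r (Iic t)),
        ENNReal.tsum_sigma' (fun r : Pos N com => x r (Iic t)), ← ENNReal.tsum_add]
      refine ENNReal.tsum_le_tsum fun w => ?_
      rw [tsum_fintype, tsum_fintype]
      exact sum_le_add_sum_of_shift (fun _ => le_rfl) fun j hj => outMeasure_Iic_le hx _ t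
    exact ne_top_of_le_ne_top (ENNReal.add_ne_top.2 ⟨hH.fin t, hx.fin t⟩) hle

theorem restrict_edgeMeasure_congr {x y : Pos N com → Measure ℝ} {t : ℝ}
    (h : ∀ r, (x r).restrict (Iio t) = (y r).restrict (Iio t)) (e : E) :
    (edgeMeasure x e).restrict (Iio t) = (edgeMeasure y e).restrict (Iio t) := by
  rw [edgeMeasure, edgeMeasure, Measure.restrict_sum _ measurableSet_Iio,
    Measure.restrict_sum _ measurableSet_Iio]
  exact congrArg _ (funext fun r => h r.1)

/-- Takes the place of a contraction estimate: each loading step extends the horizon of agreement by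
`d`. -/
theorem restrict_loadStep_congr (H : CWalk N com → Measure ℝ) {x y : Pos N com → Measure ℝ}
    (hx : IsInflow (Measure.sum x)) (hy : IsInflow (Measure.sum y)) {t d : ℝ}
    (hd : ∀ e, d ≤ N.τ e) (h : ∀ r, (x r).restrict (Iio t) = (y r).restrict (Iio t))
    (r : Pos N com) :
    (loadStep H x r).restrict (Iio (t + d)) = (loadStep H y r).restrict (Iio (t + d)) := by
  obtain ⟨w, ⟨_ | j, hj⟩⟩ := r
  · rfl
  · exact map_exit_congr (isInflow_edgeMeasure hx _) (isInflow_edgeMeasure hy _) (N.ν_pos _)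
      (hd _) (restrict_edgeMeasure_congr h _) (h _)

/-! ### Fixed points of the network loading -/

theorem Network.exists_pos_le_τ [Finite E] (N : Network V E) : ∃ d > 0, ∀ e, d ≤ N.τ e := by
  rcases isEmpty_or_nonempty E with hE | hE
  · exact ⟨1, one_pos, fun e => hE.elim e⟩
  · obtain ⟨e, he⟩ := Finite.exists_min N.τ
    exact ⟨N.τ e, N.τ_pos e, he⟩

theorem restrict_Iio_zero {μ : Measure ℝ} (h : IsInflow μ) : μ.restrict (Iio 0) = 0 :=
  Measure.restrict_eq_zero.2 h.neg

theorem isInflow_of_sum {ι : Type*} {x : ι → Measure ℝ} (hx : IsInflow (Measure.sum x)) (r : ι) :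
    IsInflow (x r) :=
  hx.mono (Measure.le_sum x r)

theorem eq_of_restrict_Iio {μ μ' : Measure ℝ} {d : ℝ} (hd : 0 < d)
    (h : ∀ n : ℕ, μ.restrict (Iio (n * d)) = μ'.restrict (Iio (n * d))) : μ = μ' := by
  have hU : ⋃ n : ℕ, Iio (n * d) = univ := by
    refine eq_univ_of_forall fun x => mem_iUnion.2 ?_
    obtain ⟨n, hn⟩ := exists_nat_gt (x / d)
    exact ⟨n, (div_lt_iff₀ hd).1 hn⟩
  have := Measure.restrict_iUnion_congr.2 h
  rwa [hU, Measure.restrict_univ, Measure.restrict_univ] at this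

theorem fixedPoint_unique [Finite E] {H : CWalk N com → Measure ℝ} {x y : Pos N com → Measure ℝ}
    (hx : IsInflow (Measure.sum x)) (hy : IsInflow (Measure.sum y)) (hxf : loadStep H x = x)
    (hyf : loadStep H y = y) : x = y := by
  obtain ⟨d, hd, hdτ⟩ := N.exists_pos_le_τ
  have key : ∀ n : ℕ, ∀ r, (x r).restrict (Iio (n * d)) = (y r).restrict (Iio (n * d)) := by
    intro n
    induction n with
    | zero =>
      intro r
      simp [restrict_Iio_zero (isInflow_of_sum hx r), restrict_Iio_zero (isInflow_of_sum hy r)]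
    | succ n ih =>
      intro r
      have := restrict_loadStep_congr H hx hy hdτ ih r
      rw [hxf, hyf] at this
      convert this using 3 <;> push_cast <;> ring
  exact funext fun r => eq_of_restrict_Iio hd fun n => key n r

/-- Measures that are consistent on an increasing sequence of sets can be glued. -/
theorem exists_glued_measure {α : Type*} [MeasurableSpace α] {s : ℕ → Set α} (hs : Monotone s)
    (hm : ∀ n, MeasurableSet (s n)) (μ : ℕ → Measure α)
    (h : ∀ n, (μ n).restrict (s n) = (μ (n + 1)).restrict (s n)) :
    ∃ κ : Measure α, ∀ n, κ.restrict (s n) = (μ n).restrict (s n) := by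
  have hmn : ∀ n k, n ≤ k → (μ n).restrict (s n) = (μ k).restrict (s n) := by
    intro n k hnk
    induction k, hnk using Nat.le_induction with
    | base => rfl
    | succ k hk ih => exact ih.trans (Measure.restrict_congr_mono (hs hk) (h k))
  have hdm : ∀ n, MeasurableSet (disjointed s n) := fun n => MeasurableSet.disjointed hm n
  -- On the part of `s n` not covered by earlier sets, use `μ n`; consistency makes any later index
  -- equally good there.
  refine ⟨Measure.sum fun n => (μ n).restrict (disjointed s n), fun k => ?_⟩
  have hU : s k = ⋃ n, s k ∩ disjointed s n := by
    refine subset_antisymm (fun x hx => ?_) (iUnion_subset fun n => inter_subset_left)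
    rw [← inter_iUnion, iUnion_disjointed]
    exact ⟨hx, mem_iUnion.2 ⟨k, hx⟩⟩
  have hdisj : Pairwise (Function.onFun Disjoint fun n => s k ∩ disjointed s n) := fun i j hij =>
    (disjoint_disjointed s hij).mono inter_subset_right inter_subset_right
  rw [Measure.restrict_sum _ (hm k)]
  conv_rhs => rw [hU, Measure.restrict_iUnion hdisj fun n => (hm k).inter (hdm n)]
  refine congrArg _ (funext fun n => ?_)
  rw [Measure.restrict_restrict (hm k)]
  rcases le_total n k with hnk | hkn
  · exact Measure.restrict_congr_mono (inter_subset_right.trans (disjointed_subset s n))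
      (hmn n k hnk)
  · exact (Measure.restrict_congr_mono inter_subset_left (hmn k n hkn)).symm

/-- The iterates started at zero no longer change before `n * d` from the `n`-th on, so they can be
glued position by position. -/
theorem exists_fixedPoint [Finite E] {H : CWalk N com → Measure ℝ} (hH : IsInflow (Measure.sum H)) :
    ∃ x : Pos N com → Measure ℝ, IsInflow (Measure.sum x) ∧ loadStep H x = x := by
  obtain ⟨d, hd, hdτ⟩ := N.exists_pos_le_τ
  let y : ℕ → Pos N com → Measure ℝ := fun n => (loadStep H)^[n] fun _ => 0
  have hy1 : ∀ n, y (n + 1) = loadStep H (y n) := fun n => Function.iterate_succ_apply' _ _ _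
  have hy : ∀ n, IsInflow (Measure.sum (y n)) := by
    intro n
    induction n with
    | zero =>
      have : Measure.sum (y 0) = 0 := by simp [y, Measure.sum_zero]
      rw [this]
      exact ⟨Measure.AbsolutelyContinuous.zero _, by simp, by simp⟩
    | succ n ih => rw [hy1]; exact isInflow_loadStep hH ih
  have hcons : ∀ n r, (y n r).restrict (Iio (n * d)) = (y (n + 1) r).restrict (Iio (n * d)) := by
    intro n
    induction n with
    | zero =>
      intro r
      simp [restrict_Iio_zero (isInflow_of_sum (hy _) r)]
    | succ n ih =>
      intro r
      have := restrict_loadStep_congr H (hy n) (hy (n + 1)) hdτ ih r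
      rw [← hy1, ← hy1] at this
      convert this using 3 <;> push_cast <;> ring
  have hsmono : Monotone fun n : ℕ => Iio ((n : ℝ) * d) := fun a b hab =>
    Iio_subset_Iio (mul_le_mul_of_nonneg_right (Nat.cast_le.2 hab) hd.le)
  choose x hx using fun r => exists_glued_measure hsmono (fun n => measurableSet_Iio)
    (fun n => y n r) (fun n => hcons n r)
  have hsum : ∀ n : ℕ, (Measure.sum x).restrict (Iio (n * d)) =
      (Measure.sum (y n)).restrict (Iio (n * d)) := fun n => by
    rw [Measure.restrict_sum _ measurableSet_Iio, Measure.restrict_sum _ measurableSet_Iio]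
    exact congrArg _ (funext fun r => hx r n)
  have hval : ∀ (n : ℕ) (s : Set ℝ), s ⊆ Iio (n * d) → Measure.sum x s = Measure.sum (y n) s :=
    fun n s hs => by
      rw [← Measure.restrict_eq_self _ hs, hsum, Measure.restrict_eq_self _ hs]
  have hxi : IsInflow (Measure.sum x) := by
    refine ⟨fun s hs => ?_, ?_, fun t => ?_⟩
    · have hU : s ⊆ ⋃ n : ℕ, s ∩ Iio (n * d) := fun z hz => by
        obtain ⟨n, hn⟩ := exists_nat_gt (z / d)
        exact mem_iUnion.2 ⟨n, hz, (div_lt_iff₀ hd).1 hn⟩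
      refine measure_mono_null hU (measure_iUnion_null fun n => ?_)
      rw [hval n _ inter_subset_right]
      exact (hy n).ac (measure_mono_null inter_subset_left hs)
    · rw [hval 0 _ (by simp)]
      exact (hy 0).neg
    · obtain ⟨n, hn⟩ := exists_nat_gt (t / d)
      rw [hval n _ (Iic_subset_Iio.2 ((div_lt_iff₀ hd).1 hn))]
      exact (hy n).fin t
  refine ⟨x, hxi, funext fun r => eq_of_restrict_Iio hd fun n => ?_⟩
  -- The glued family agrees with iterate `n` before `n * d`, so its image agrees there with iterate
  -- `n + 1`, hence with iterate `n` and with the glued family itself.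
  have h1 := restrict_loadStep_congr H hxi (hy n) hdτ (fun r => hx r n) r
  rw [← hy1] at h1
  have h2 : Iio ((n : ℝ) * d) ⊆ Iio (n * d + d) := Iio_subset_Iio (by linarith)
  exact (Measure.restrict_congr_mono h2 h1).trans ((hcons n r).symm.trans (hx r n).symm)

end

/-! ### Link transfer determines the exit time and the outflow -/

namespace IsInflow

variable {μ κ : Measure ℝ} {ν τ : ℝ}

/-- Link transfer together with the capacity constraint forces the queue to operate at capacity, so
that the exit time is determined by the inflow. -/
theorem eq_exit_of_link (hμ : IsInflow μ) (hκ : IsInflow κ) (hν : 0 < ν) (hκτ : mass κ τ = 0)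
    (hcap : ∀ s t, τ ≤ s → s ≤ t → mass κ t - mass κ s ≤ ν * (t - s))
    (hweak : ∀ θ, 0 ≤ θ → mass κ (θ + τ) ≤ mass μ θ)
    (hlink : ∀ θ, 0 ≤ θ → mass κ (θ + (τ + (mass μ θ - mass κ (θ + τ)) / ν)) = mass μ θ)
    {θ : ℝ} (hθ : 0 ≤ θ) : θ + (τ + (mass μ θ - mass κ (θ + τ)) / ν) = exit ν τ μ θ := by
  set S : ℝ → ℝ := fun θ => θ + (τ + (mass μ θ - mass κ (θ + τ)) / ν) with hS
  have hcμ := hμ.continuous_mass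
  have hcκ := hκ.continuous_mass
  have hScont : Continuous S := by fun_prop
  have hSν : ∀ s, ν * S s = ν * (s + τ) + (mass μ s - mass κ (s + τ)) := fun s => by
    simp only [hS]; field_simp; ring
  have hS0 : S 0 = τ := by simp [hS, hμ.mass_of_nonpos le_rfl, hκτ]
  have hSle : ∀ s, 0 ≤ s → s + τ ≤ S s := fun s hs => by
    have := div_nonneg (sub_nonneg.2 (hweak s hs)) hν.le
    simp only [hS]; linarith
  -- Up to the constant `ν * τ`, this is the capacity left unused during `[τ, s + τ]`; the capacity
  -- bound makes it monotone on `[0, ∞)`.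
  let G : ℝ → ℝ := fun s => ν * (s + τ) - mass κ (s + τ)
  have hGcont : Continuous G := by fun_prop
  have hGmono : ∀ s t, 0 ≤ s → s ≤ t → G s ≤ G t := fun s t hs hst => by
    have := hcap (s + τ) (t + τ) (by linarith) (by linarith)
    simp only [G]; linarith
  -- From exit time `s₀ + τ` until `θ + τ` the edge works at full capacity, and `s₀` is the earliest
  -- such start.
  obtain ⟨s₀, ⟨⟨h0, hsθ⟩, hG0⟩, hmin⟩ : ∃ s₀, IsLeast (Icc 0 θ ∩ {s | G s = G θ}) s₀ :=
    (isCompact_Icc.inter_right (isClosed_eq hGcont continuous_const)).exists_isLeast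
      ⟨θ, ⟨hθ, le_rfl⟩, rfl⟩
  obtain ⟨s, ⟨hs0, hss⟩, hs⟩ : s₀ + τ ∈ S '' Icc 0 s₀ :=
    intermediate_value_Icc h0 hScont.continuousOn ⟨by rw [hS0]; linarith, hSle _ h0⟩
  -- Link transfer for the entry time `s` with exit time `s₀ + τ` says that no capacity is wasted in
  -- between. Minimality then gives `s = s₀`: the queue is empty at `s₀`, which is where the
  -- supremum defining `slack` is attained.
  have hGs : G s = G s₀ := by
    have h1 := hlink s hs0
    have h2 := hSν s
    change mass κ (S s) = mass μ s at h1
    rw [hs] at h1 h2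
    simp only [G]; linarith
  have hs_eq : s = s₀ := le_antisymm hss (hmin ⟨⟨hs0, hss.trans hsθ⟩, hGs.trans hG0⟩)
  subst hs_eq
  have hslack : slack ν μ θ = θ - mass κ (θ + τ) / ν := by
    have hν' : ν ≠ 0 := hν.ne'
    refine le_antisymm (slack_le fun r hr => ?_) ?_
    · have : ∀ r, 0 ≤ r → r ≤ θ → r - mass μ r / ν ≤ θ - mass κ (θ + τ) / ν := fun r hr0 hr => by
        have h1 := hGmono r θ hr0 hr
        have h2 := hweak r hr0
        simp only [G] at h1
        have h3 : (ν * r - mass μ r) / ν ≤ (ν * θ - mass κ (θ + τ)) / ν :=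
          div_le_div_of_nonneg_right (by linarith) hν.le
        rwa [sub_div, sub_div, mul_div_cancel_left₀ _ hν', mul_div_cancel_left₀ _ hν'] at h3
      rcases le_total 0 r with h | h
      · exact this r h hr
      · have h1 := this 0 le_rfl hθ
        rw [hμ.mass_of_nonpos le_rfl] at h1
        rw [hμ.mass_of_nonpos h]
        linarith
    · have h1 := hμ.le_slack hν hsθ
      have h2 := hSν s
      rw [hs] at h2
      have h3 : (ν * θ - mass κ (θ + τ)) / ν = (ν * s - mass μ s) / ν := by
        congr 1
        have h4 : G s = G θ := hG0
        simp only [G] at h4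
        linarith
      rw [sub_div, sub_div, mul_div_cancel_left₀ _ hν', mul_div_cancel_left₀ _ hν'] at h3
      linarith
  simp only [exit, hslack]
  ring

/-- Every real number is an exit time, so link transfer fixes the cumulative mass everywhere;
negative entry times are covered because `κ'` has no mass up to `τ`. -/
theorem eq_map_exit_of_link (hμ : IsInflow μ) (hν : 0 < ν) {μ' κ' : Measure ℝ} (h : μ' ≤ μ)
    (hκ : IsInflow κ') (hκτ : mass κ' τ = 0)
    (hlink : ∀ θ, 0 ≤ θ → mass κ' (exit ν τ μ θ) = mass μ' θ) :
    κ' = μ'.map (exit ν τ μ) := by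
  have hμ' := hμ.mono h
  have hle : μ'.map (exit ν τ μ) ≤ μ.map (exit ν τ μ) :=
    Measure.map_mono h (hμ.continuous_exit hν).measurable
  refine ext_of_mass hκ.fin (fun t => ne_top_of_le_ne_top (hμ.map_exit_Iic_ne_top hν t) (hle _))
    fun c => ?_
  obtain ⟨σ, rfl, -⟩ := hμ.exists_exit_eq hν τ c
  have h1 : mass (μ'.map (exit ν τ μ)) (exit ν τ μ σ) = mass μ' σ :=
    congrArg ENNReal.toReal (hμ.map_exit_Iic hν h σ)
  rw [h1]
  rcases le_total 0 σ with hσ | hσ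
  · exact hlink σ hσ
  · rw [hμ'.mass_of_nonpos hσ, hμ.exit_of_nonpos hν hσ]
    exact le_antisymm ((hκ.monotone_mass (by linarith)).trans hκτ.le) (mass_nonneg _ _)

end IsInflow

/-! ### Measures with given rates -/

/-- The measure on `[0, ∞)` with the given rate as its density. -/
noncomputable def rateMeasure (g : ℝ → ℝ) : Measure ℝ :=
  timeMeasure.withDensity fun z => ENNReal.ofReal (g z)

theorem timeMeasure_withDensity_ac (F : ℝ → ℝ≥0∞) : timeMeasure.withDensity F ≪ volume :=
  (withDensity_absolutelyContinuous _ _).trans Measure.absolutelyContinuous_restrict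

theorem timeMeasure_withDensity_Iio (F : ℝ → ℝ≥0∞) : timeMeasure.withDensity F (Iio 0) = 0 :=
  withDensity_absolutelyContinuous _ _ (by
    rw [timeMeasure, Measure.restrict_apply measurableSet_Iio]
    have : Iio (0 : ℝ) ∩ Ici 0 = ∅ := by ext x; simp
    simp [this])

theorem timeMeasure_withDensity_Iic (F : ℝ → ℝ≥0∞) (θ : ℝ) :
    timeMeasure.withDensity F (Iic θ) = ∫⁻ z in Ioc 0 θ, F z := by
  rw [withDensity_apply _ measurableSet_Iic, timeMeasure,
    Measure.restrict_restrict measurableSet_Iic, inter_comm, Ici_inter_Iic]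
  exact setLIntegral_congr Ioc_ae_eq_Icc.symm

theorem isInflow_rateMeasure {g : ℝ → ℝ} (hg : MemLp g 2 timeMeasure) :
    IsInflow (rateMeasure g) where
  ac := timeMeasure_withDensity_ac _
  neg := timeMeasure_withDensity_Iio _
  fin t := by
    rw [rateMeasure, timeMeasure_withDensity_Iic]
    have h1 : MemLp g 2 (volume.restrict (Ioc 0 t)) :=
      hg.mono_measure (Measure.restrict_mono (fun x hx => hx.1.le) le_rfl)
    exact (h1.integrable (by norm_num)).lintegral_lt_top.ne

theorem mass_rateMeasure {g : ℝ → ℝ} (hg : MemLp g 2 timeMeasure)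
    (h0 : ∀ᵐ θ ∂timeMeasure, 0 ≤ g θ) {θ : ℝ} (hθ : 0 ≤ θ) : mass (rateMeasure g) θ = cum g θ := by
  have hle : volume.restrict (Ioc 0 θ) ≤ timeMeasure :=
    Measure.restrict_mono (fun x hx => hx.1.le) le_rfl
  rw [cum, intervalIntegral.integral_of_le hθ,
    integral_eq_lintegral_of_nonneg_ae (ae_mono hle h0) (hg.1.mono_measure hle), mass,
    measureReal_def, rateMeasure, timeMeasure_withDensity_Iic]

theorem rateMeasure_Iio (g : ℝ → ℝ) : rateMeasure g (Iio 0) = 0 :=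
  timeMeasure_withDensity_Iio _

instance : SigmaFinite timeMeasure := by unfold timeMeasure; infer_instance

theorem ae_eq_of_rateMeasure_eq {g g' : ℝ → ℝ} (hg : AEStronglyMeasurable g timeMeasure)
    (hg' : AEStronglyMeasurable g' timeMeasure) (h0 : ∀ᵐ θ ∂timeMeasure, 0 ≤ g θ)
    (h0' : ∀ᵐ θ ∂timeMeasure, 0 ≤ g' θ) (h : rateMeasure g = rateMeasure g') :
    g =ᵐ[timeMeasure] g' := by
  have := (withDensity_eq_iff_of_sigmaFinite hg.aemeasurable.ennreal_ofReal
    hg'.aemeasurable.ennreal_ofReal).1 h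
  filter_upwards [this, h0, h0'] with z hz h1 h2
  exact (ENNReal.ofReal_eq_ofReal_iff h1 h2).1 hz

theorem rateMeasure_congr {g g' : ℝ → ℝ} (h : g =ᵐ[timeMeasure] g') :
    rateMeasure g = rateMeasure g' :=
  withDensity_congr_ae (h.mono fun z hz => by simp only [hz])

theorem sum_rateMeasure {ι : Type*} [Countable ι] {g : ι → ℝ → ℝ}
    (hg : ∀ r, AEStronglyMeasurable (g r) timeMeasure) :
    Measure.sum (fun r => rateMeasure (g r)) =
      timeMeasure.withDensity fun z => ∑' r, ENNReal.ofReal (g r z) := by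
  ext s hs
  rw [Measure.sum_apply _ hs, withDensity_apply _ hs,
    lintegral_tsum fun r => (hg r).aemeasurable.ennreal_ofReal.restrict]
  exact tsum_congr fun r => withDensity_apply _ hs

/-! ### Feasible flows are fixed points -/

section

variable {V E I : Type*} {N : Network V E} {com : I → Commodity V}

theorem edgeMeasure_rateMeasure [Finite E] [Finite I] {g : Pos N com → ℝ → ℝ}
    (hg : ∀ r, AEStronglyMeasurable (g r) timeMeasure) (e : E) :
    edgeMeasure (fun r => rateMeasure (g r)) e = timeMeasure.withDensity (aggRate g e) :=
  sum_rateMeasure fun r : {r : Pos N com // r.edge = e} => hg r.1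

theorem edgeMeasure_rateMeasure_Iic [Finite E] [Finite I] {g : Pos N com → ℝ → ℝ}
    (hg : ∀ r, AEStronglyMeasurable (g r) timeMeasure) (e : E) (θ : ℝ) :
    edgeMeasure (fun r => rateMeasure (g r)) e (Iic θ) = aggCum g e θ := by
  rw [edgeMeasure_rateMeasure hg, timeMeasure_withDensity_Iic, aggCum]

theorem sum_apply_eq_sum_edgeMeasure [Fintype E] (x : Pos N com → Measure ℝ) {s : Set ℝ}
    (hs : MeasurableSet s) : Measure.sum x s = ∑ e, edgeMeasure x e s := by
  rw [← tsum_fintype (L := SummationFilter.unconditional _), Measure.sum_apply _ hs,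
    ← ENNReal.tsum_fiberwise (fun r => x r s) Pos.edge]
  exact tsum_congr fun e => (Measure.sum_apply _ hs).symm

/-- The total inflow into the network is finite. -/
theorem sum_rateMeasure_walkFlow_ne_top [Finite E] [Finite I] {h : CWalk N com → ℝ → ℝ}
    (hh : h ∈ walkFlows N com) : Measure.sum (fun w => rateMeasure (h w)) univ ≠ ∞ := by
  have := Fintype.ofFinite I
  rw [sum_rateMeasure fun w => (hh.1 w).1, withDensity_apply _ MeasurableSet.univ,
    Measure.restrict_univ]
  have a3 : ∀ᵐ z ∂timeMeasure, ∀ w, 0 ≤ h w z := ae_all_iff.2 hh.2.1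
  have a4 := ae_all_iff.2 hh.2.2.2
  have key : ∫⁻ z, ∑' w, ENNReal.ofReal (h w z) ∂timeMeasure =
      ∫⁻ z, ∑ i, ENNReal.ofReal ((com i).u z) ∂timeMeasure := by
    refine lintegral_congr_ae ?_
    filter_upwards [a3, a4] with z b3 b4
    rw [ENNReal.tsum_sigma', tsum_fintype]
    refine Finset.sum_congr rfl fun i _ => ?_
    rw [← (b4 i).tsum_eq, ENNReal.ofReal_tsum_of_nonneg (fun W => b3 _) (b4 i).summable]
  have hu : ∀ i, Integrable (com i).u timeMeasure := fun i => (com i).u_integrable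
  rw [key, lintegral_finsetSum' _ fun i _ => (hu i).aemeasurable.ennreal_ofReal]
  exact ENNReal.sum_ne_top.2 fun i _ => (hu i).lintegral_lt_top.ne

theorem isInflow_sum_rateMeasure_walkFlow [Finite E] [Finite I] {h : CWalk N com → ℝ → ℝ}
    (hh : h ∈ walkFlows N com) : IsInflow (Measure.sum fun w => rateMeasure (h w)) where
  ac := Measure.absolutelyContinuous_sum_left fun _ => timeMeasure_withDensity_ac _
  neg := by
    rw [Measure.sum_apply _ measurableSet_Iio]
    simp [rateMeasure_Iio]
  fin t := ne_top_of_le_ne_top (sum_rateMeasure_walkFlow_ne_top hh) (measure_mono (subset_univ _))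

theorem FlowOverTime.exitTime_eq [Finite E] [Finite I] (g : FlowOverTime N com) (e : E) (θ : ℝ) :
    g.exitTime e θ = θ + (N.τ e + (mass (edgeMeasure (fun r => rateMeasure (g.inflow r)) e) θ -
      mass (edgeMeasure (fun r => rateMeasure (g.outflow r)) e) (θ + N.τ e)) / N.ν e) := by
  simp only [mass, measureReal_def, edgeMeasure_rateMeasure_Iic fun r => (g.inflow_memLp r).1,
    edgeMeasure_rateMeasure_Iic fun r => (g.outflow_memLp r).1]
  rfl

namespace FlowOverTime.IsFeasible

variable {g : FlowOverTime N com} {h : CWalk N com → ℝ → ℝ}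

/-- Link transfer summed over all positions on the edge; the sum is taken in `[0, ∞]`, so no
summability has to be checked. -/
theorem mass_outflow_exitTime (hg : g.IsFeasible h) (e : E) {θ : ℝ} (hθ : 0 ≤ θ)
    (hT : 0 ≤ g.exitTime e θ) :
    mass (edgeMeasure (fun r => rateMeasure (g.outflow r)) e) (g.exitTime e θ) =
      mass (edgeMeasure (fun r => rateMeasure (g.inflow r)) e) θ := by
  rw [mass, mass, measureReal_def, measureReal_def, edgeMeasure, edgeMeasure,
    Measure.sum_apply _ measurableSet_Iic, Measure.sum_apply _ measurableSet_Iic]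
  congr 1
  refine tsum_congr fun r => ?_
  have h1 := hg.link_transfer r.1 θ hθ
  rw [r.2, ← mass_rateMeasure (g.outflow_memLp _) (g.outflow_nonneg _) hT,
    ← mass_rateMeasure (g.inflow_memLp _) (g.inflow_nonneg _) hθ] at h1
  have h2 := congrArg ENNReal.ofReal h1
  rwa [(isInflow_rateMeasure (g.outflow_memLp _)).ofReal_mass,
    (isInflow_rateMeasure (g.inflow_memLp _)).ofReal_mass] at h2

variable [Finite E] [Finite I]

theorem isInflow_sum_inflow (hg : g.IsFeasible h) (hh : h ∈ walkFlows N com) :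
    IsInflow (Measure.sum fun r => rateMeasure (g.inflow r)) where
  ac := Measure.absolutelyContinuous_sum_left fun _ => timeMeasure_withDensity_ac _
  neg := by
    rw [Measure.sum_apply _ measurableSet_Iio]
    simp [rateMeasure_Iio]
  fin t := by
    have := Fintype.ofFinite E
    rw [sum_apply_eq_sum_edgeMeasure _ measurableSet_Iic]
    refine ENNReal.sum_ne_top.2 fun e _ => ?_
    rw [edgeMeasure_rateMeasure_Iic fun r => (g.inflow_memLp r).1]
    exact hg.aggCum_inflow_ne_top hh e t

theorem isInflow_edgeMeasure_outflow (hg : g.IsFeasible h) (e : E) :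
    IsInflow (edgeMeasure (fun r => rateMeasure (g.outflow r)) e) := by
  have hm := fun r => (g.outflow_memLp r).1
  refine ⟨?_, ?_, fun t => ?_⟩
  · rw [edgeMeasure_rateMeasure hm]
    exact timeMeasure_withDensity_ac _
  · rw [edgeMeasure_rateMeasure hm]
    exact timeMeasure_withDensity_Iio _
  · rw [edgeMeasure_rateMeasure_Iic hm]
    exact hg.aggCum_outflow_ne_top e t

theorem mass_outflow_sub_le (hg : g.IsFeasible h) (e : E) {s t : ℝ} (hs : N.τ e ≤ s)
    (hst : s ≤ t) : mass (edgeMeasure (fun r => rateMeasure (g.outflow r)) e) t -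
      mass (edgeMeasure (fun r => rateMeasure (g.outflow r)) e) s ≤ N.ν e * (t - s) := by
  have hκ := hg.isInflow_edgeMeasure_outflow e
  have hm := fun r => (g.outflow_memLp r).1
  have hcap : ∀ᵐ x : ℝ, x ∈ Ioc s t → aggRate g.outflow e x ≤ ENNReal.ofReal (N.ν e) := by
    have h1 := (ae_restrict_iff' measurableSet_Ici).1 (hg.capacity e)
    have h2 := (measurePreserving_sub_right volume (N.τ e)).quasiMeasurePreserving.ae h1
    filter_upwards [h2] with x hx hm
    have := hx (show (0 : ℝ) ≤ x - N.τ e by linarith [hm.1])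
    simpa using this
  have hle : edgeMeasure (fun r => rateMeasure (g.outflow r)) e (Ioc s t) ≤
      ENNReal.ofReal (N.ν e * (t - s)) := by
    rw [edgeMeasure_rateMeasure hm, withDensity_apply _ measurableSet_Ioc]
    refine (lintegral_mono' (Measure.restrict_mono subset_rfl Measure.restrict_le_self)
      le_rfl).trans ((setLIntegral_mono_ae' measurableSet_Ioc hcap).trans_eq ?_)
    rw [setLIntegral_const, Real.volume_Ioc, ← ENNReal.ofReal_mul (N.ν_pos e).le]
  rw [measure_Ioc_eq_sub hκ.fin hst] at hle
  exact (ENNReal.ofReal_le_ofReal_iff (mul_nonneg (N.ν_pos e).le (sub_nonneg.2 hst))).1 hle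

theorem mass_outflow_τ (hg : g.IsFeasible h) (e : E) :
    mass (edgeMeasure (fun r => rateMeasure (g.outflow r)) e) (N.τ e) = 0 := by
  have h0 : aggCum g.outflow e (N.τ e) = 0 := by
    have := hg.weak_conservation e 0 le_rfl
    simpa [aggCum] using this
  rw [mass, measureReal_def, edgeMeasure_rateMeasure_Iic fun r => (g.outflow_memLp r).1, h0]
  rfl

theorem mass_outflow_le (hg : g.IsFeasible h) (hh : h ∈ walkFlows N com) (e : E) {θ : ℝ}
    (hθ : 0 ≤ θ) :
    mass (edgeMeasure (fun r => rateMeasure (g.outflow r)) e) (θ + N.τ e) ≤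
      mass (edgeMeasure (fun r => rateMeasure (g.inflow r)) e) θ := by
  rw [mass, mass, measureReal_def, measureReal_def,
    edgeMeasure_rateMeasure_Iic fun r => (g.inflow_memLp r).1,
    edgeMeasure_rateMeasure_Iic fun r => (g.outflow_memLp r).1]
  exact ENNReal.toReal_mono (hg.aggCum_inflow_ne_top hh e θ) (hg.weak_conservation e θ hθ)

theorem exitTime_nonneg (hg : g.IsFeasible h) (hh : h ∈ walkFlows N com) (e : E) {θ : ℝ}
    (hθ : 0 ≤ θ) : 0 ≤ g.exitTime e θ := by
  have := div_nonneg (sub_nonneg.2 (hg.mass_outflow_le hh e hθ)) (N.ν_pos e).le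
  rw [exitTime_eq]
  linarith [N.τ_pos e]

theorem exitTime_eq_edgeExit (hg : g.IsFeasible h) (hh : h ∈ walkFlows N com) (e : E) {θ : ℝ}
    (hθ : 0 ≤ θ) : g.exitTime e θ = edgeExit (fun r => rateMeasure (g.inflow r)) e θ := by
  rw [exitTime_eq]
  refine (isInflow_edgeMeasure (hg.isInflow_sum_inflow hh) e).eq_exit_of_link
    (hg.isInflow_edgeMeasure_outflow e) (N.ν_pos e) (hg.mass_outflow_τ e)
    (fun s t => hg.mass_outflow_sub_le e) (fun θ => hg.mass_outflow_le hh e)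
    (fun θ hθ => ?_) hθ
  have := hg.mass_outflow_exitTime e hθ (hg.exitTime_nonneg hh e hθ)
  rwa [exitTime_eq] at this

theorem rateMeasure_outflow (hg : g.IsFeasible h) (hh : h ∈ walkFlows N com) (r : Pos N com) :
    rateMeasure (g.outflow r) = outMeasure (fun r => rateMeasure (g.inflow r)) r := by
  have hle : mass (rateMeasure (g.outflow r)) (N.τ r.edge) ≤
      mass (edgeMeasure (fun r => rateMeasure (g.outflow r)) r.edge) (N.τ r.edge) :=
    ENNReal.toReal_mono ((hg.isInflow_edgeMeasure_outflow _).fin _)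
      (le_edgeMeasure (fun r => rateMeasure (g.outflow r)) r _)
  rw [hg.mass_outflow_τ] at hle
  refine (isInflow_edgeMeasure (hg.isInflow_sum_inflow hh) _).eq_map_exit_of_link (N.ν_pos _)
    (le_edgeMeasure (fun r => rateMeasure (g.inflow r)) r) (isInflow_rateMeasure
    (g.outflow_memLp r)) (le_antisymm hle (mass_nonneg _ _)) fun θ hθ => ?_
  have h1 := hg.link_transfer r θ hθ
  rw [← mass_rateMeasure (g.outflow_memLp _) (g.outflow_nonneg _) (hg.exitTime_nonneg hh _ hθ),
    ← mass_rateMeasure (g.inflow_memLp _) (g.inflow_nonneg _) hθ,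
    hg.exitTime_eq_edgeExit hh _ hθ] at h1
  exact h1

/-- The source condition handles first edges; node balancing combined with the forced form of the
outflow handles the others. -/
theorem loadStep_rateMeasure (hg : g.IsFeasible h) (hh : h ∈ walkFlows N com) :
    loadStep (fun w => rateMeasure (h w)) (fun r => rateMeasure (g.inflow r)) =
      fun r => rateMeasure (g.inflow r) := by
  funext r
  obtain ⟨w, ⟨_ | j, hj⟩⟩ := r
  · exact (rateMeasure_congr (hg.source w hj)).symm
  · exact (hg.rateMeasure_outflow hh _).symm.trans (rateMeasure_congr (hg.balance w j hj))

end FlowOverTime.IsFeasible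
end

/-! ### Recovering rates from measures -/

/-- The rate of a measure: its density as a real function. -/
noncomputable def rate (μ : Measure ℝ) (θ : ℝ) : ℝ := (μ.rnDeriv volume θ).toReal

theorem rate_nonneg (μ : Measure ℝ) (θ : ℝ) : 0 ≤ rate μ θ := ENNReal.toReal_nonneg

theorem measurable_rate (μ : Measure ℝ) : Measurable (rate μ) :=
  (Measure.measurable_rnDeriv μ volume).ennreal_toReal

/-- Radon-Nikodym; cutting the density off to `[0, ∞)` loses nothing because `μ` has no mass below
`0`. -/
theorem rateMeasure_rate {μ : Measure ℝ} (hμ : IsInflow μ) : rateMeasure (rate μ) = μ := by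
  have := isLocallyFiniteMeasure_of_Iic hμ.fin
  have h1 : (fun z => ENNReal.ofReal (rate μ z)) =ᵐ[volume] μ.rnDeriv volume :=
    (Measure.rnDeriv_lt_top μ volume).mono fun z hz => ENNReal.ofReal_toReal hz.ne
  rw [rateMeasure, timeMeasure, ← restrict_withDensity measurableSet_Ici,
    withDensity_congr_ae h1, Measure.withDensity_rnDeriv_eq _ _ hμ.ac]
  refine Measure.restrict_eq_self_of_ae_mem ?_
  rw [ae_iff]
  convert hμ.neg using 2
  ext x
  simp

theorem integrable_rate {μ : Measure ℝ} (hμ : μ univ ≠ ∞) : Integrable (rate μ) timeMeasure := by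
  have : IsFiniteMeasure μ := ⟨hμ.lt_top⟩
  exact Measure.integrable_toReal_rnDeriv.integrableOn

theorem ae_le_of_withDensity_le_smul {F : ℝ → ℝ≥0∞} (hF : AEMeasurable F timeMeasure) {c : ℝ}
    (h : timeMeasure.withDensity F ≤ ENNReal.ofReal c • volume) :
    ∀ᵐ θ ∂timeMeasure, F θ ≤ ENNReal.ofReal c := by
  refine ae_le_of_forall_setLIntegral_le_of_sigmaFinite₀ hF fun s hs _ => ?_
  have hs' : MeasurableSet (s ∩ Ici 0) := hs.inter measurableSet_Ici
  have h1 := h (s ∩ Ici 0)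
  rw [withDensity_apply _ hs', timeMeasure, Measure.restrict_restrict hs', inter_assoc,
    inter_self] at h1
  rw [setLIntegral_const, timeMeasure, Measure.restrict_restrict hs, Measure.restrict_apply hs]
  exact h1

/-- The rate is almost everywhere at most `c`, so its square is at most `c` times the rate, which is
integrable. -/
theorem memLp_two_rate {μ : Measure ℝ} (hμ : IsInflow μ) (hfin : μ univ ≠ ∞) {c : ℝ} (hc : 0 ≤ c)
    (h : μ ≤ ENNReal.ofReal c • volume) : MemLp (rate μ) 2 timeMeasure := by
  have hm := (measurable_rate μ).aestronglyMeasurable (μ := timeMeasure)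
  rw [← rateMeasure_rate hμ] at h
  have hle := ae_le_of_withDensity_le_smul hm.aemeasurable.ennreal_ofReal h
  rw [memLp_two_iff_integrable_sq hm]
  refine ((integrable_rate hfin).const_mul c).mono' (hm.pow 2) ?_
  filter_upwards [hle] with z hz
  rw [Real.norm_of_nonneg (sq_nonneg _), sq]
  exact mul_le_mul_of_nonneg_right ((ENNReal.ofReal_le_ofReal_iff hc).1 hz) (rate_nonneg _ _)

/-! ### The feasible flow given by a fixed point -/

section

variable {V E I : Type*} {N : Network V E} {com : I → Commodity V}

theorem outMeasure_le {x : Pos N com → Measure ℝ} (hx : IsInflow (Measure.sum x)) (r : Pos N com) :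
    outMeasure x r ≤ ENNReal.ofReal (N.ν r.edge) • volume :=
  (le_edgeMeasure (outMeasure x) r).trans (edgeMeasure_outMeasure_le hx _)

theorem outMeasure_univ {x : Pos N com → Measure ℝ} (hx : IsInflow (Measure.sum x))
    (r : Pos N com) : outMeasure x r univ = x r univ := by
  rw [outMeasure, Measure.map_apply (measurable_edgeExit hx _) MeasurableSet.univ, preimage_univ]

/-- Pushforwards preserve total mass, so every position carries the full mass of its walk. This
gives integrability on the whole half-line, beyond finiteness on bounded horizons. -/
theorem fixedPoint_univ_ne_top {H : CWalk N com → Measure ℝ} {x : Pos N com → Measure ℝ}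
    (hH : ∀ w, H w univ ≠ ∞) (hx : IsInflow (Measure.sum x)) (hfix : loadStep H x = x)
    (r : Pos N com) : x r univ ≠ ∞ := by
  obtain ⟨w, ⟨j, hj⟩⟩ := r
  induction j with
  | zero =>
    rw [← hfix]
    exact hH w
  | succ j ih =>
    have h1 : x ⟨w, ⟨j + 1, hj⟩⟩ = outMeasure x ⟨w, ⟨j, (Nat.lt_succ_self j).trans hj⟩⟩ :=
      (congrFun hfix ⟨w, ⟨j + 1, hj⟩⟩).symm
    rw [h1, outMeasure_univ hx]
    exact ih _

variable {h : CWalk N com → ℝ → ℝ} {x : Pos N com → Measure ℝ}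

theorem rate_source (hh : h ∈ walkFlows N com) (hx : IsInflow (Measure.sum x))
    (hfix : loadStep (fun w => rateMeasure (h w)) x = x) (w : CWalk N com)
    (hj : 0 < w.2.1.length) : rate (x ⟨w, ⟨0, hj⟩⟩) =ᵐ[timeMeasure] h w := by
  refine ae_eq_of_rateMeasure_eq (measurable_rate _).aestronglyMeasurable (hh.1 w).1
    (.of_forall fun _ => rate_nonneg _ _) (hh.2.1 w) ?_
  rw [rateMeasure_rate (isInflow_of_sum hx _)]
  exact (congrFun hfix ⟨w, ⟨0, hj⟩⟩).symm

variable [Finite E] [Finite I]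

theorem memLp_outflow_rate (hh : h ∈ walkFlows N com) (hx : IsInflow (Measure.sum x))
    (hfix : loadStep (fun w => rateMeasure (h w)) x = x) (r : Pos N com) :
    MemLp (rate (outMeasure x r)) 2 timeMeasure := by
  refine memLp_two_rate (isInflow_outMeasure hx r) ?_ (N.ν_pos _).le (outMeasure_le hx r)
  rw [outMeasure_univ hx]
  exact fixedPoint_univ_ne_top (fun w => ne_top_of_le_ne_top (sum_rateMeasure_walkFlow_ne_top hh)
    (Measure.le_sum (fun w => rateMeasure (h w)) w _)) hx hfix r

/-- The flow over time given by a fixed point of the network loading. -/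
noncomputable def flowOfFixedPoint (hh : h ∈ walkFlows N com) (hx : IsInflow (Measure.sum x))
    (hfix : loadStep (fun w => rateMeasure (h w)) x = x) : FlowOverTime N com where
  inflow r := rate (x r)
  outflow r := rate (outMeasure x r)
  inflow_memLp := by
    -- On the first edge the rate is the given walk-flow, whose square integrability is assumed but
    -- which need not be bounded by any capacity; later inflows are outflows of an edge.
    rintro ⟨w, ⟨_ | j, hj⟩⟩
    · exact (memLp_congr_ae (rate_source hh hx hfix w hj)).2 (hh.1 w)
    · rw [← hfix]
      exact memLp_outflow_rate hh hx hfix _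
  outflow_memLp := memLp_outflow_rate hh hx hfix
  inflow_nonneg _ := .of_forall fun _ => rate_nonneg _ _
  outflow_nonneg _ := .of_forall fun _ => rate_nonneg _ _

theorem flowOfFixedPoint_isFeasible (hh : h ∈ walkFlows N com) (hx : IsInflow (Measure.sum x))
    (hfix : loadStep (fun w => rateMeasure (h w)) x = x) :
    (flowOfFixedPoint hh hx hfix).IsFeasible h := by
  set f := flowOfFixedPoint hh hx hfix
  have hin : (fun r => rateMeasure (f.inflow r)) = x :=
    funext fun r => rateMeasure_rate (isInflow_of_sum hx r)
  have hout : (fun r => rateMeasure (f.outflow r)) = outMeasure x :=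
    funext fun r => rateMeasure_rate (isInflow_outMeasure hx r)
  have hmin : ∀ r, AEStronglyMeasurable (f.inflow r) timeMeasure := fun r => (f.inflow_memLp r).1
  have hmout : ∀ r, AEStronglyMeasurable (f.outflow r) timeMeasure :=
    fun r => (f.outflow_memLp r).1
  have hedge := fun e => isInflow_edgeMeasure hx e
  have hmass : ∀ e θ, mass (edgeMeasure x e) θ - mass (edgeMeasure (outMeasure x) e) (θ + N.τ e) =
      N.ν e * (edgeExit x e θ - (θ + N.τ e)) := fun e θ => by
    rw [edgeMeasure_outMeasure hx]
    exact (hedge e).mass_sub_mass_map_exit (N.ν_pos e) θ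
  have hle : ∀ e θ, θ + N.τ e ≤ edgeExit x e θ := fun e θ => (hedge e).add_le_exit (N.ν_pos e) θ
  have hexit : ∀ e θ, f.exitTime e θ = edgeExit x e θ := fun e θ => by
    rw [FlowOverTime.exitTime_eq, hin, hout, hmass, mul_div_cancel_left₀ _ (N.ν_pos e).ne']
    ring
  refine ⟨rate_source hh hx hfix, fun w j hj => ?_, fun e => ?_, fun e θ hθ => ?_,
    fun r θ hθ => ?_⟩
  · have h1 : x ⟨w, ⟨j + 1, hj⟩⟩ = outMeasure x ⟨w, ⟨j, (Nat.lt_succ_self j).trans hj⟩⟩ :=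
      (congrFun hfix ⟨w, ⟨j + 1, hj⟩⟩).symm
    exact .of_forall fun θ => by simp only [f, flowOfFixedPoint, h1]
  · have h1 : timeMeasure.withDensity (aggRate f.outflow e) ≤
        ENNReal.ofReal (N.ν e) • volume := by
      rw [← edgeMeasure_rateMeasure hmout, hout]
      exact edgeMeasure_outMeasure_le hx e
    have hagg : AEMeasurable (aggRate f.outflow e) timeMeasure :=
      AEMeasurable.tsum fun r => (hmout r.1).aemeasurable.ennreal_ofReal
    have h2 := (ae_restrict_iff' measurableSet_Ici).1 (ae_le_of_withDensity_le_smul hagg h1)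
    have h3 := (measurePreserving_add_right volume (N.τ e)).quasiMeasurePreserving.ae h2
    refine (ae_restrict_iff' measurableSet_Ici).2 (h3.mono fun θ hθ h0 => hθ ?_)
    exact add_nonneg h0 (N.τ_pos e).le
  · rw [← edgeMeasure_rateMeasure_Iic hmout, ← edgeMeasure_rateMeasure_Iic hmin, hin, hout]
    have hfin : IsInflow (edgeMeasure (outMeasure x) e) := by
      rw [edgeMeasure_outMeasure hx]
      exact (hedge e).map_exit (N.ν_pos e) (N.τ_pos e).le
    rw [← hfin.ofReal_mass, ← (hedge e).ofReal_mass]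
    refine ENNReal.ofReal_le_ofReal (sub_nonneg.1 ?_)
    rw [hmass]
    exact mul_nonneg (N.ν_pos e).le (sub_nonneg.2 (hle e θ))
  · have h0 : 0 ≤ edgeExit x r.edge θ := by linarith [hle r.edge θ, N.τ_pos r.edge]
    rw [hexit, ← mass_rateMeasure (f.outflow_memLp r) (f.outflow_nonneg r) h0,
      ← mass_rateMeasure (f.inflow_memLp r) (f.inflow_nonneg r) hθ, congrFun hin r,
      congrFun hout r]
    exact congrArg ENNReal.toReal ((hedge r.edge).map_exit_Iic (N.ν_pos _) (le_edgeMeasure x r) θ)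

end
end Vickrey

theorem mainTheorem4 {V E I : Type*} [Finite V] [Finite E] [Finite I]
    (N : Vickrey.Network V E) (com : I → Vickrey.Commodity V)
    (h : Vickrey.CWalk N com → ℝ → ℝ) (hh : h ∈ Vickrey.walkFlows N com) :
    ∃ f : Vickrey.FlowOverTime N com, f.IsFeasible h ∧
      ∀ g : Vickrey.FlowOverTime N com, g.IsFeasible h →
        ∀ r : Vickrey.Pos N com,
          g.inflow r =ᵐ[Vickrey.timeMeasure] f.inflow r ∧
          g.outflow r =ᵐ[Vickrey.timeMeasure] f.outflow r := by
  obtain ⟨x, hx, hfix⟩ :=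
    Vickrey.exists_fixedPoint (Vickrey.isInflow_sum_rateMeasure_walkFlow hh)
  have hf := Vickrey.flowOfFixedPoint_isFeasible hh hx hfix
  refine ⟨_, hf, fun g hg r => ?_⟩
  have heq := Vickrey.fixedPoint_unique (hg.isInflow_sum_inflow hh) (hf.isInflow_sum_inflow hh)
    (hg.loadStep_rateMeasure hh) (hf.loadStep_rateMeasure hh)
  refine ⟨Vickrey.ae_eq_of_rateMeasure_eq (g.inflow_memLp r).1
    (Vickrey.FlowOverTime.inflow_memLp _ r).1 (g.inflow_nonneg r)
    (Vickrey.FlowOverTime.inflow_nonneg _ r) (congrFun heq r),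
    Vickrey.ae_eq_of_rateMeasure_eq (g.outflow_memLp r).1
    (Vickrey.FlowOverTime.outflow_memLp _ r).1 (g.outflow_nonneg r)
    (Vickrey.FlowOverTime.outflow_nonneg _ r) ?_⟩
  -- Outflow measures are a function of the inflow measures, which are already known to coincide.
  rw [hg.rateMeasure_outflow hh, hf.rateMeasure_outflow hh, heq]
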